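/- Let $n\ge 0$ be an integer. The Aztec diamond $AD(n)$ of order $n$ is the union of all unit squares $[a,a+1]\times[b,b+1]$ with $a,b\in\mathbb{Z}$ that are contained in the region $|x|+|y|\le n+1$ of the plane. Its planar dual graph, the Aztec diamond graph of order $n$, has these unit squares as vertices, and two of them are adjacent exactly when they share an edge. Let $M(AD(n))$ denote the number of perfect matchings of this graph. An alternating sign matrix of order $n$ is an $n\times n$ matrix with entries in $\{0,1,-1\}$ such that all row sums and all column sums equal $1$ and the nonzero entries alternate in sign along each row and each column. Let $\mathcal{A}_n$ be the set of all alternating sign matrices of order $n$, and for $A\in\mathcal{A}_n$ let $N_+(A)$ be the number of entries of $A$ equal to $1$. Then $$M(AD(n))=\sum_{A\in\mathcal{A}_n}2^{N_+(A)}.$$ -/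

import Mathlib

namespace Aztec

/-- The unit square `[a, a+1] × [b, b+1]` with lower left corner `s = (a, b)` lies in the region
`|x| + |y| ≤ n + 1`. The maximum of `|x|` on `[a, a+1]` is `max |a| |a+1|`; see
`inDiamond_iff` for the description by real points. -/
def InDiamond (n : ℕ) (s : ℤ × ℤ) : Prop :=
  max |s.1| |s.1 + 1| + max |s.2| |s.2 + 1| ≤ (n : ℤ) + 1

theorem inDiamond_iff (n : ℕ) (s : ℤ × ℤ) :
    InDiamond n s ↔ ∀ x y : ℝ, x ∈ Set.Icc (s.1 : ℝ) (s.1 + 1) → y ∈ Set.Icc (s.2 : ℝ) (s.2 + 1) →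
      |x| + |y| ≤ (n : ℝ) + 1 := by
  have key : InDiamond n s ↔
      max |(s.1 : ℝ)| |(s.1 : ℝ) + 1| + max |(s.2 : ℝ)| |(s.2 : ℝ) + 1| ≤ (n : ℝ) + 1 := by
    unfold InDiamond
    exact_mod_cast Iff.rfl
  rw [key]
  constructor
  · intro h x y hx hy
    have h1 : |x| ≤ max |(s.1 : ℝ)| |(s.1 : ℝ) + 1| := abs_le_max_abs_abs hx.1 hx.2
    have h2 : |y| ≤ max |(s.2 : ℝ)| |(s.2 : ℝ) + 1| := abs_le_max_abs_abs hy.1 hy.2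
    linarith
  · intro h
    have l1 : (s.1 : ℝ) ∈ Set.Icc (s.1 : ℝ) (s.1 + 1) := ⟨le_refl _, by linarith⟩
    have r1 : (s.1 : ℝ) + 1 ∈ Set.Icc (s.1 : ℝ) (s.1 + 1) := ⟨by linarith, le_refl _⟩
    have l2 : (s.2 : ℝ) ∈ Set.Icc (s.2 : ℝ) (s.2 + 1) := ⟨le_refl _, by linarith⟩
    have r2 : (s.2 : ℝ) + 1 ∈ Set.Icc (s.2 : ℝ) (s.2 + 1) := ⟨by linarith, le_refl _⟩
    rcases max_choice |(s.1 : ℝ)| |(s.1 : ℝ) + 1| with e1 | e1 <;>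
      rcases max_choice |(s.2 : ℝ)| |(s.2 : ℝ) + 1| with e2 | e2 <;> rw [e1, e2]
    exacts [h _ _ l1 l2, h _ _ l1 r2, h _ _ r1 l2, h _ _ r1 r2]

/-- The unit squares of the Aztec diamond of order `n`, given by their lower left corners. -/
abbrev Cell (n : ℕ) : Type := {s : ℤ × ℤ // InDiamond n s}

instance (n : ℕ) : Finite (Cell n) := by
  apply Set.Finite.to_subtype
  apply (Set.finite_Icc ((-(n : ℤ) - 1, -(n : ℤ) - 1) : ℤ × ℤ) ((n : ℤ) + 1, (n : ℤ) + 1)).subset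
  rintro ⟨a, b⟩ h
  have h : max |a| |a + 1| + max |b| |b + 1| ≤ (n : ℤ) + 1 := h
  simp only [Set.mem_Icc, Prod.mk_le_mk]
  have h1 := le_max_left |a| |a + 1|
  have h2 := le_max_left |b| |b + 1|
  have h3 := neg_abs_le a
  have h4 := neg_abs_le b
  have h5 := le_abs_self a
  have h6 := le_abs_self b
  have h7 := abs_nonneg a
  have h8 := abs_nonneg b
  omega

/-- The Aztec diamond graph of order `n`: the planar dual graph of the Aztec diamond. Its vertices
are the unit squares, and two unit squares are adjacent when they share an edge. -/
def graph (n : ℕ) : SimpleGraph (Cell n) where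
  Adj s t := |s.1.1 - t.1.1| + |s.1.2 - t.1.2| = 1
  symm := ⟨fun s t h => by rwa [abs_sub_comm t.1.1, abs_sub_comm t.1.2]⟩
  loopless := ⟨fun s h => by simp at h⟩

/-- The number of perfect matchings of a graph with finitely many vertices. -/
noncomputable def numPerfectMatchings {V : Type*} [Finite V] (G : SimpleGraph V) : ℕ :=
  Nat.card {M : G.Subgraph // M.IsPerfectMatching}

/-- A vector whose nonzero entries alternate in sign: any two consecutive nonzero entries have
opposite signs. -/
def SignsAlternate {n : ℕ} (v : Fin n → ℤ) : Prop :=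
  ∀ j k : Fin n, j < k → v j ≠ 0 → v k ≠ 0 → (∀ l, j < l → l < k → v l = 0) →
    SignType.sign (v k) = -SignType.sign (v j)

/-- Alternating sign matrices of order `n`. -/
structure IsASM {n : ℕ} (A : Matrix (Fin n) (Fin n) ℤ) : Prop where
  entries : ∀ i j, A i j = 0 ∨ A i j = 1 ∨ A i j = -1
  row_sum : ∀ i, ∑ j, A i j = 1
  col_sum : ∀ j, ∑ i, A i j = 1
  row_alternate : ∀ i, SignsAlternate fun j => A i j
  col_alternate : ∀ j, SignsAlternate fun i => A i j

theorem finite_setOf_isASM (n : ℕ) : {A : Matrix (Fin n) (Fin n) ℤ | IsASM A}.Finite := by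
  have hf : (Set.univ.pi fun _ : Fin n => Set.univ.pi fun _ : Fin n =>
      ({0, 1, -1} : Set ℤ)).Finite :=
    Set.Finite.pi fun _ => Set.Finite.pi fun _ => Set.toFinite _
  exact hf.subset fun A hA i _ j _ => hA.entries i j

/-- The set `𝒜ₙ` of all alternating sign matrices of order `n`, as a finset. -/
noncomputable def ASM (n : ℕ) : Finset (Matrix (Fin n) (Fin n) ℤ) :=
  (finite_setOf_isASM n).toFinset

theorem mem_ASM {n : ℕ} {A : Matrix (Fin n) (Fin n) ℤ} : A ∈ ASM n ↔ IsASM A := by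
  simp [ASM]

/-- The number of entries of `A` that are equal to `1`. -/
def numOnes {n : ℕ} (A : Matrix (Fin n) (Fin n) ℤ) : ℕ :=
  (Finset.univ.filter fun p : Fin n × Fin n => A p.1 p.2 = 1).card

end Aztec

namespace Aztec

open Finset

/-! ### Perfect matchings as sets of edges -/

/-! Every edge joins two of the four unit squares around exactly one of `n * n` lattice points
(sites), so a matching selects edges from a 4-cycle at each site. By parity the squares form two
families: one is a union of chains of `n + 1` squares, each threading the `n` sites of a column; the
other does the same for rows. Let the matrix entry at a site be the number of selected edges there
minus one. Since each square is covered once, the edges at the first `m` sites of a chain cover its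
first `m` squares and possibly the next one. Hence partial sums are 0 or 1 with total 1, which
characterises alternating sign matrices (`isASM_iff_partialSum`).

Conversely, the partial sums of a given matrix dictate from which site each square is covered
(`isMatching_and_excess_eq_iff`). What remains is an independent choice at each site: a unique one,
except that an entry 1 allows both perfect matchings of the 4-cycle (`card_local`). This gives the
fibre size in `card_fibre`. -/

theorem card_perfectMatching_eq {V E : Type*} (G : SimpleGraph V) (ends : E → Sym2 V)
    (hinj : Function.Injective ends) (hrange : ∀ s, s ∈ G.edgeSet ↔ ∃ e, ends e = s) :
    Nat.card {M : G.Subgraph // M.IsPerfectMatching} =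
      Nat.card {x : E → Bool // ∀ v, ∃! e, x e = true ∧ v ∈ ends e} := by
  classical
  let sub : (E → Bool) → G.Subgraph := fun x =>
    { verts := Set.univ
      Adj := fun v w => ∃ e, x e = true ∧ ends e = s(v, w)
      adj_sub := by
        rintro v w ⟨e, -, he⟩
        exact (hrange s(v, w)).2 ⟨e, he⟩
      edge_vert := fun _ => Set.mem_univ _
      symm := ⟨by
        rintro v w ⟨e, hx, he⟩
        exact ⟨e, hx, he.trans Sym2.eq_swap⟩⟩ }
  have hsub : ∀ x, (∀ v, ∃! e, x e = true ∧ v ∈ ends e) → (sub x).IsPerfectMatching := by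
    intro x hx
    rw [SimpleGraph.Subgraph.isPerfectMatching_iff]
    intro v
    obtain ⟨e, ⟨hxe, hve⟩, huniq⟩ := hx v
    obtain ⟨w, hw⟩ := hve
    refine ⟨w, ⟨e, hxe, hw⟩, ?_⟩
    rintro w' ⟨e', hxe', hw'⟩
    have he : e' = e := huniq e' ⟨hxe', by simp [hw']⟩
    subst he
    exact (Sym2.congr_right.1 (hw'.symm.trans hw))
  have hset : ∀ M : G.Subgraph, M.IsPerfectMatching →
      ∀ v, ∃! e, decide (ends e ∈ M.edgeSet) = true ∧ v ∈ ends e := by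
    intro M hM v
    rw [SimpleGraph.Subgraph.isPerfectMatching_iff] at hM
    obtain ⟨w, hw, huniq⟩ := hM v
    obtain ⟨e, he⟩ := (hrange s(v, w)).1 (M.adj_sub hw)
    refine ⟨e, ⟨by simpa [he] using hw, by simp [he]⟩, ?_⟩
    rintro e' ⟨hM', w', hw'⟩
    rw [hw'] at hM'
    have : w' = w := huniq w' (by simpa using hM')
    exact hinj (by rw [hw', he, this])
  refine Nat.card_congr
    { toFun := fun M => ⟨fun e => decide (ends e ∈ M.1.edgeSet), hset M.1 M.2⟩
      invFun := fun x => ⟨sub x.1, hsub x.1 x.2⟩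
      left_inv := ?_
      right_inv := ?_ }
  · rintro ⟨M, hM⟩
    apply Subtype.ext
    apply SimpleGraph.Subgraph.ext
    · exact (Set.eq_univ_of_forall hM.2).symm
    · funext v w
      apply propext
      constructor
      · rintro ⟨e, h, he⟩
        have h := of_decide_eq_true h
        rw [he] at h
        exact h
      · intro h
        obtain ⟨e, he⟩ := (hrange s(v, w)).1 (M.adj_sub h)
        refine ⟨e, decide_eq_true ?_, he⟩
        rw [he]
        exact h
  · rintro ⟨x, hx⟩
    apply Subtype.ext
    funext e
    rw [Bool.eq_iff_iff, decide_eq_true_iff]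
    obtain ⟨v, w, hvw⟩ : ∃ v w, ends e = s(v, w) := by
      induction h : ends e with | _ v w => exact ⟨v, w, rfl⟩
    constructor
    · intro h
      rw [hvw] at h
      obtain ⟨e', hx', he'⟩ := h
      rwa [hinj (hvw.trans he'.symm)]
    · intro h
      rw [hvw]
      exact ⟨e, h, hvw⟩

/-! ### Partial sums and alternating vectors -/

/-- The sum of the entries of `v` with index less than `m`. -/
def partialSum {n : ℕ} (v : Fin n → ℤ) (m : ℕ) : ℤ :=
  ∑ i : Fin n, if i.val < m then v i else 0

theorem partialSum_zero {n : ℕ} (v : Fin n → ℤ) : partialSum v 0 = 0 := by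
  simp [partialSum]

theorem partialSum_self {n : ℕ} (v : Fin n → ℤ) : partialSum v n = ∑ i, v i := by
  simp [partialSum]

theorem partialSum_succ {n : ℕ} (v : Fin n → ℤ) (i : Fin n) :
    partialSum v (i + 1) = partialSum v i + v i := by
  have : v i = ∑ k : Fin n, if k = i then v k else 0 := by simp
  rw [partialSum, partialSum, this, ← sum_add_distrib]
  refine sum_congr rfl fun k _ => ?_
  have := @Fin.ext_iff n k i
  rcases lt_trichotomy k.val i.val with h | h | h
  · simp [this, h, h.ne, h.trans (Nat.lt_succ_self _)]
  · simp [this, h]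
  · simp [this, h.ne', h.not_gt, Nat.not_lt.2 (Nat.succ_le_of_lt h)]

theorem SignsAlternate.abs_partialSum_sub_le {n : ℕ} {v : Fin n → ℤ} (hv : SignsAlternate v)
    (hent : ∀ i, v i = 0 ∨ v i = 1 ∨ v i = -1) {l m : ℕ} (hlm : l ≤ m) (hm : m ≤ n) :
    |partialSum v m - partialSum v l| ≤ 1 := by
  -- Track the last nonzero entry of the window: alternation makes the window sum either 0 or that
  -- entry.
  have key : ((∀ i : Fin n, l ≤ i.val → i.val < m → v i = 0) ∧
        partialSum v m = partialSum v l) ∨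
      ∃ k : Fin n, k.val < m ∧ v k ≠ 0 ∧ (∀ i : Fin n, k < i → i.val < m → v i = 0) ∧
        (partialSum v m - partialSum v l = 0 ∨ partialSum v m - partialSum v l = v k) := by
    induction m, hlm using Nat.le_induction with
    | base => exact Or.inl ⟨fun i h1 h2 => by omega, rfl⟩
    | succ m hlm ih =>
      have hs := partialSum_succ v ⟨m, hm⟩
      simp only at hs
      have hlast : ∀ i : Fin n, i.val < m + 1 → i.val < m ∨ i = ⟨m, hm⟩ := by
        intro i hi
        rw [Fin.ext_iff]
        exact Nat.lt_succ_iff_lt_or_eq.1 hi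
      by_cases h0 : v ⟨m, hm⟩ = 0
      · rw [hs, h0, add_zero]
        rcases ih (by omega) with ⟨h1, h2⟩ | ⟨k, h1, h2, h3, h4⟩
        · refine Or.inl ⟨fun i hi hi' => ?_, h2⟩
          rcases hlast i hi' with h | rfl
          exacts [h1 i hi h, h0]
        · refine Or.inr ⟨k, by omega, h2, fun i hi hi' => ?_, h4⟩
          rcases hlast i hi' with h | rfl
          exacts [h3 i hi h, h0]
      · refine Or.inr ⟨⟨m, hm⟩, by simp, h0, fun i hi hi' => ?_, ?_⟩
        · rw [Fin.lt_def] at hi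
          simp only at hi
          omega
        · rcases ih (by omega) with ⟨h1, h2⟩ | ⟨k, h1, h2, h3, h4⟩
          · right
            rw [hs, h2]
            ring
          · have hsign := hv k ⟨m, hm⟩ h1 h2 h0 fun i hi hi' => h3 i hi hi'
            have hneg : v ⟨m, hm⟩ = -v k := by
              rcases hent k with h | h | h <;> rcases hent ⟨m, hm⟩ with h' | h' | h' <;>
                simp_all
            rw [hs]
            rcases h4 with h4 | h4
            · right; linarith
            · left; linarith
  rcases key with ⟨-, h⟩ | ⟨k, -, -, -, h | h⟩
  · simp [h]
  · simp [h]
  · rw [h]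
    rcases hent k with h' | h' | h' <;> simp [h']

/-- The windows before and after `m` sum to `s` and `1 - s`, both of absolute value at most 1, which
forces `s` to be 0 or 1. -/
theorem SignsAlternate.partialSum_eq {n : ℕ} {v : Fin n → ℤ} (hv : SignsAlternate v)
    (hent : ∀ i, v i = 0 ∨ v i = 1 ∨ v i = -1) (hsum : ∑ i, v i = 1) {m : ℕ} (hm : m ≤ n) :
    partialSum v m = 0 ∨ partialSum v m = 1 := by
  have h1 := abs_le.1 (hv.abs_partialSum_sub_le hent (Nat.zero_le m) hm)
  have h2 := abs_le.1 (hv.abs_partialSum_sub_le hent hm le_rfl)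
  rw [partialSum_self, hsum] at h2
  rw [partialSum_zero] at h1
  omega

theorem entry_of_partialSum {n : ℕ} {v : Fin n → ℤ}
    (h : ∀ m ≤ n, partialSum v m = 0 ∨ partialSum v m = 1) (i : Fin n) :
    v i = 0 ∨ v i = 1 ∨ v i = -1 := by
  have h1 := h i i.2.le
  have h2 := h (i + 1) i.2
  have h3 := partialSum_succ v i
  omega

/-- Partial sums are constant between consecutive nonzero entries, and a sequence confined to {0, 1}
cannot step twice in the same direction. -/
theorem signsAlternate_of_partialSum {n : ℕ} {v : Fin n → ℤ}
    (h : ∀ m ≤ n, partialSum v m = 0 ∨ partialSum v m = 1) : SignsAlternate v := by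
  intro j k hjk hj hk hz
  have hconst : ∀ m, j.val + 1 ≤ m → m ≤ k.val → partialSum v m = partialSum v (j + 1) := by
    intro m hm
    induction m, hm using Nat.le_induction with
    | base => exact fun _ => rfl
    | succ m hm ih =>
      intro hmk
      have hs := partialSum_succ v ⟨m, by omega⟩
      rw [hz ⟨m, by omega⟩ (Fin.lt_def.2 (by simp only; omega))
        (Fin.lt_def.2 (by simp only; omega)), add_zero] at hs
      exact hs.trans (ih (by omega))
  have e := hconst k hjk le_rfl
  have h1 := h j j.2.le
  have h2 := h (j + 1) j.2
  have h3 := partialSum_succ v j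
  have h4 := h (k + 1) k.2
  have h5 := partialSum_succ v k
  have : (v j = 1 ∧ v k = -1) ∨ (v j = -1 ∧ v k = 1) := by omega
  rcases this with ⟨a, b⟩ | ⟨a, b⟩ <;> simp [a, b]

theorem isASM_iff_partialSum {n : ℕ} {A : Matrix (Fin n) (Fin n) ℤ} :
    IsASM A ↔
      (∀ i, partialSum (fun j => A i j) n = 1 ∧ ∀ m ≤ n,
        partialSum (fun j => A i j) m = 0 ∨ partialSum (fun j => A i j) m = 1) ∧
      (∀ j, partialSum (fun i => A i j) n = 1 ∧ ∀ m ≤ n,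
        partialSum (fun i => A i j) m = 0 ∨ partialSum (fun i => A i j) m = 1) := by
  constructor
  · intro h
    exact ⟨fun i => ⟨(partialSum_self _).trans (h.row_sum i), fun m hm =>
        (h.row_alternate i).partialSum_eq (fun j => h.entries i j) (h.row_sum i) hm⟩,
      fun j => ⟨(partialSum_self _).trans (h.col_sum j), fun m hm =>
        (h.col_alternate j).partialSum_eq (fun i => h.entries i j) (h.col_sum j) hm⟩⟩
  · rintro ⟨hr, hc⟩
    exact
      { entries := fun i j => entry_of_partialSum (hr i).2 j
        row_sum := fun i => (partialSum_self _).symm.trans (hr i).1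
        col_sum := fun j => (partialSum_self _).symm.trans (hc j).1
        row_alternate := fun i => signsAlternate_of_partialSum (hr i).2
        col_alternate := fun j => signsAlternate_of_partialSum (hc j).2 }

/-! ### Chains of cells -/

/-- Position `k ∈ {0, …, n}` of a chain lies between its links `k - 1` and `k`. The end `a` of
link `i` is at position `i + a`. Each position is covered by exactly one selected edge. -/
def Covers {n : ℕ} (y : Fin n → Bool → Bool → Bool) : Prop :=
  ∀ k ≤ n, ∃! q : Fin n × Bool × Bool, y q.1 q.2.1 q.2.2 = true ∧ q.1.val + q.2.1.toNat = k

/-- The number of selected edges at the end `a` of a link. -/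
def degree (z : Bool → Bool → Bool) (a : Bool) : ℤ := (z a false).toNat + (z a true).toNat

theorem degree_nonneg (z : Bool → Bool → Bool) (a : Bool) : 0 ≤ degree z a := by
  unfold degree
  positivity

/-- The number of selected edges at position `k` which belong to link `k`. -/
def degreeAbove {n : ℕ} (y : Fin n → Bool → Bool → Bool) (k : ℕ) : ℤ :=
  ∑ i : Fin n, if i.val = k then degree (y i) false else 0

/-- The number of selected edges at position `k` which belong to link `k - 1`. -/
def degreeBelow {n : ℕ} (y : Fin n → Bool → Bool → Bool) (k : ℕ) : ℤ :=
  ∑ i : Fin n, if i.val + 1 = k then degree (y i) true else 0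

theorem covers_iff {n : ℕ} (y : Fin n → Bool → Bool → Bool) :
    Covers y ↔ ∀ k ≤ n, degreeAbove y k + degreeBelow y k = 1 := by
  classical
  refine forall₂_congr fun k _ => ?_
  have h1 : (∃! q : Fin n × Bool × Bool, y q.1 q.2.1 q.2.2 = true ∧ q.1.val + q.2.1.toNat = k) ↔
      #{q : Fin n × Bool × Bool | y q.1 q.2.1 q.2.2 = true ∧ q.1.val + q.2.1.toNat = k} = 1 := by
    rw [Finset.card_eq_one]
    simp only [Finset.ext_iff, ExistsUnique, mem_filter_univ, mem_singleton]
    refine exists_congr fun q => ⟨fun h q' => ⟨h.2 q', ?_⟩, fun h => ⟨(h q).2 rfl, fun q' => (h q').1⟩⟩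
    rintro rfl
    exact h.1
  rw [h1, ← Nat.cast_inj (R := ℤ), card_filter, Nat.cast_one]
  push_cast
  rw [degreeAbove, degreeBelow, ← sum_add_distrib, Fintype.sum_prod_type]
  refine Eq.congr_left (sum_congr rfl fun i _ => ?_)
  simp only [Fintype.sum_prod_type, Fintype.sum_bool, degree, Bool.toNat_true, Bool.toNat_false,
    add_zero]
  rw [add_comm]
  congr 1
  · by_cases h : i.val = k <;> cases y i false false <;> cases y i false true <;> simp [h]
  · by_cases h : i.val + 1 = k <;> cases y i true false <;> cases y i true true <;> simp [h]

theorem degreeAbove_coe {n : ℕ} (y : Fin n → Bool → Bool → Bool) (i : Fin n) :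
    degreeAbove y i = degree (y i) false := by
  simp [degreeAbove, ← Fin.ext_iff]

theorem degreeBelow_succ {n : ℕ} (y : Fin n → Bool → Bool → Bool) (i : Fin n) :
    degreeBelow y (i + 1) = degree (y i) true := by
  simp [degreeBelow, ← Fin.ext_iff]

theorem degreeAbove_self {n : ℕ} (y : Fin n → Bool → Bool → Bool) : degreeAbove y n = 0 :=
  sum_eq_zero fun i _ => if_neg i.2.ne

theorem degreeBelow_zero {n : ℕ} (y : Fin n → Bool → Bool → Bool) : degreeBelow y 0 = 0 :=
  sum_eq_zero fun i _ => if_neg (Nat.succ_ne_zero i)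

/-- Telescoping: coverage of position `m` turns the degree of link `m` at its lower end into one
minus what link `m - 1` contributes there. -/
theorem Covers.partialSum_eq {n : ℕ} {y : Fin n → Bool → Bool → Bool} (hy : Covers y)
    {v : Fin n → ℤ} (hv : ∀ i, v i = degree (y i) false + degree (y i) true - 1) {m : ℕ}
    (hm : m ≤ n) : partialSum v m = degreeBelow y m := by
  rw [covers_iff] at hy
  induction m with
  | zero => rw [partialSum_zero, degreeBelow_zero]
  | succ m ih =>
    have h1 := partialSum_succ v ⟨m, hm⟩
    have h2 := degreeAbove_coe y ⟨m, hm⟩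
    have h3 := degreeBelow_succ y ⟨m, hm⟩
    have h4 := hv ⟨m, hm⟩
    have h5 := ih (by omega)
    have h6 := hy m (by omega)
    simp only at h1 h2 h3
    linarith

theorem Covers.partialSum_mem {n : ℕ} {y : Fin n → Bool → Bool → Bool} (hy : Covers y)
    {v : Fin n → ℤ} (hv : ∀ i, v i = degree (y i) false + degree (y i) true - 1) :
    partialSum v n = 1 ∧ ∀ m ≤ n, partialSum v m = 0 ∨ partialSum v m = 1 := by
  have nonneg_above (k) : 0 ≤ degreeAbove y k :=
    sum_nonneg fun i _ => by split_ifs <;> simp [degree_nonneg]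
  have nonneg_below (k) : 0 ≤ degreeBelow y k :=
    sum_nonneg fun i _ => by split_ifs <;> simp [degree_nonneg]
  refine ⟨?_, fun m hm => ?_⟩
  · have := (covers_iff y).1 hy n le_rfl
    rwa [hy.partialSum_eq hv le_rfl, ← zero_add (degreeBelow y n), ← degreeAbove_self y]
  · have h1 := (covers_iff y).1 hy m hm
    have h2 := nonneg_above m
    have h3 := nonneg_below m
    rw [hy.partialSum_eq hv hm]
    omega

/-- In the converse, `hn` supplies coverage of the last position `n`, which has no link above it. -/
theorem covers_iff_partialSum {n : ℕ} {y : Fin n → Bool → Bool → Bool} {v : Fin n → ℤ}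
    (hn : partialSum v n = 1) :
    (Covers y ∧ ∀ i, v i = degree (y i) false + degree (y i) true - 1) ↔
      ∀ i : Fin n, degree (y i) false = 1 - partialSum v i ∧
        degree (y i) true = partialSum v (i + 1) := by
  constructor
  · rintro ⟨hy, hv⟩ i
    have h1 := (covers_iff y).1 hy i i.2.le
    rw [hy.partialSum_eq hv i.2.le, hy.partialSum_eq hv i.2, degreeBelow_succ, ← degreeAbove_coe]
    exact ⟨by linarith, rfl⟩
  · intro h
    refine ⟨(covers_iff y).2 fun k hk => ?_, fun i => ?_⟩
    · have habove : degreeAbove y k = 1 - partialSum v k := by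
        rcases hk.eq_or_lt with rfl | hk
        · rw [degreeAbove_self, hn, sub_self]
        · exact (degreeAbove_coe y ⟨k, hk⟩).trans (h ⟨k, hk⟩).1
      have hbelow : degreeBelow y k = partialSum v k := by
        cases k with
        | zero => rw [degreeBelow_zero, partialSum_zero]
        | succ m => exact (degreeBelow_succ y ⟨m, hk⟩).trans (h ⟨m, hk⟩).2
      linarith
    · rw [(h i).1, (h i).2, partialSum_succ]
      ring

/-! ### Coordinates on the Aztec diamond -/

theorem inDiamond_iff_linear {n : ℕ} {a b : ℤ} :
    InDiamond n (a, b) ↔ a + b + 1 ≤ n ∧ -(a + b + 1) ≤ n ∧ a - b ≤ n ∧ b - a ≤ n := by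
  unfold InDiamond
  simp only
  rcases abs_cases a with ⟨h1, h1'⟩ | ⟨h1, h1'⟩ <;>
  rcases abs_cases b with ⟨h2, h2'⟩ | ⟨h2, h2'⟩ <;>
  rcases abs_cases (a + 1) with ⟨h3, h3'⟩ | ⟨h3, h3'⟩ <;>
  rcases abs_cases (b + 1) with ⟨h4, h4'⟩ | ⟨h4, h4'⟩ <;>
  rw [h1, h2, h3, h4] <;> omega

/-- The edges of the Aztec diamond graph: the sites `(i, j)` are the lattice points
`(i - j, i + j + 1 - n)`; the edge `((i, j), (a, b))` is one of the four edges between the unit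
squares around that point. -/
abbrev EdgeIndex (n : ℕ) : Type := (Fin n × Fin n) × Bool × Bool

/-- The unit square below (`a = false`) or above (`a = true`) the site in the first coordinate. -/
def vCell {n : ℕ} (p : Fin n × Fin n) (a : Bool) : Cell n :=
  ⟨((p.1 : ℤ) - p.2 - 1 + a.toNat, (p.1 : ℤ) + p.2 - n + a.toNat), by
    have h1 := p.1.2
    have h2 := p.2.2
    rw [inDiamond_iff_linear]
    cases a <;> simp <;> omega⟩

/-- The unit square below (`b = false`) or above (`b = true`) the site in the second
coordinate. -/
def hCell {n : ℕ} (p : Fin n × Fin n) (b : Bool) : Cell n :=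
  ⟨((p.1 : ℤ) - p.2 - b.toNat, (p.1 : ℤ) + p.2 - n + b.toNat), by
    have h1 := p.1.2
    have h2 := p.2.2
    rw [inDiamond_iff_linear]
    cases b <;> simp <;> omega⟩

/-- The two ends of an edge. -/
def ends {n : ℕ} (e : EdgeIndex n) : Sym2 (Cell n) := s(vCell e.1 e.2.1, hCell e.1 e.2.2)

theorem vCell_eq_iff {n : ℕ} {p : Fin n × Fin n} {a : Bool} {c : Cell n} :
    c = vCell p a ↔ c.1.1 = (p.1 : ℤ) - p.2 - 1 + a.toNat ∧ c.1.2 = (p.1 : ℤ) + p.2 - n + a.toNat := by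
  rw [Subtype.ext_iff, Prod.ext_iff]
  rfl

theorem hCell_eq_iff {n : ℕ} {p : Fin n × Fin n} {b : Bool} {c : Cell n} :
    c = hCell p b ↔ c.1.1 = (p.1 : ℤ) - p.2 - b.toNat ∧ c.1.2 = (p.1 : ℤ) + p.2 - n + b.toNat := by
  rw [Subtype.ext_iff, Prod.ext_iff]
  rfl

theorem vCell_ne_hCell {n : ℕ} (p q : Fin n × Fin n) (a b : Bool) : vCell p a ≠ hCell q b := by
  -- Coordinate sum plus `n` is odd for a `vCell` and even for an `hCell`.
  rw [Ne, hCell_eq_iff]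
  simp only [vCell]
  omega

theorem ends_injective (n : ℕ) : Function.Injective (ends (n := n)) := by
  rintro ⟨⟨i, j⟩, a, b⟩ ⟨⟨i', j'⟩, a', b'⟩ h
  simp only [ends, Sym2.eq_iff] at h
  rcases h with ⟨h1, h2⟩ | ⟨h1, -⟩
  · rw [vCell_eq_iff] at h1
    rw [hCell_eq_iff] at h2
    simp only [vCell, hCell] at h1 h2
    simp only [Prod.mk.injEq, Fin.ext_iff]
    cases a <;> cases b <;> cases a' <;> cases b' <;>
      simp only [Bool.toNat_true, Bool.toNat_false] at h1 h2 <;> simp <;> omega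
  · exact absurd h1 (vCell_ne_hCell _ _ _ _)

theorem exists_ends_of_odd {n : ℕ} {s t : Cell n} (h : (graph n).Adj s t)
    (hs : (s.1.1 + s.1.2 + n) % 2 = 1) : ∃ e, ends e = s(s, t) := by
  obtain ⟨⟨α, β⟩, hst⟩ := s
  obtain ⟨⟨γ, δ⟩, htt⟩ := t
  have h : |α - γ| + |β - δ| = 1 := h
  simp only at hs
  rw [inDiamond_iff_linear] at hst htt
  have hcase : (γ = α ∧ δ = β + 1) ∨ (γ = α ∧ δ = β - 1) ∨ (γ = α + 1 ∧ δ = β) ∨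
      (γ = α - 1 ∧ δ = β) := by
    rcases abs_cases (α - γ) with ⟨h1, h1'⟩ | ⟨h1, h1'⟩ <;>
    rcases abs_cases (β - δ) with ⟨h2, h2'⟩ | ⟨h2, h2'⟩ <;> omega
  -- The odd square `s` must be the `vCell` and `t` the `hCell`; `i`, `j`, `a`, `b` solve the
  -- resulting linear equations.
  obtain ⟨i, hi⟩ : ∃ i : Fin n, 2 * (i : ℤ) = γ + δ + n :=
    ⟨⟨((γ + δ + n) / 2).toNat, by omega⟩, by simp only; omega⟩
  obtain ⟨j, hj⟩ : ∃ j : Fin n, 2 * (j : ℤ) = β - α + n - 1 :=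
    ⟨⟨((β - α + n - 1) / 2).toNat, by omega⟩, by simp only; omega⟩
  obtain ⟨a, ha⟩ : ∃ a : Bool, 2 * (a.toNat : ℤ) = α + β + 1 - γ - δ := by
    have : α + β + 1 - γ - δ = 0 ∨ α + β + 1 - γ - δ = 2 := by omega
    rcases this with h | h
    exacts [⟨false, by simp [h]⟩, ⟨true, by simp [h]⟩]
  obtain ⟨b, hb⟩ : ∃ b : Bool, 2 * (b.toNat : ℤ) = δ - γ - β + α + 1 := by
    have : δ - γ - β + α + 1 = 0 ∨ δ - γ - β + α + 1 = 2 := by omega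
    rcases this with h | h
    exacts [⟨false, by simp [h]⟩, ⟨true, by simp [h]⟩]
  refine ⟨((i, j), (a, b)), Sym2.eq_iff.2 (Or.inl ⟨?_, ?_⟩)⟩
  · rw [eq_comm, vCell_eq_iff]
    simp only
    omega
  · rw [eq_comm, hCell_eq_iff]
    simp only
    omega

theorem mem_edgeSet_iff {n : ℕ} (s : Sym2 (Cell n)) :
    s ∈ (graph n).edgeSet ↔ ∃ e, ends e = s := by
  constructor
  · induction s with | _ s t
    intro h
    rw [SimpleGraph.mem_edgeSet] at h
    rcases Int.emod_two_eq_zero_or_one (s.1.1 + s.1.2 + n) with hs | hs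
    · rw [Sym2.eq_swap]
      refine exists_ends_of_odd h.symm ?_
      have h : |s.1.1 - t.1.1| + |s.1.2 - t.1.2| = 1 := h
      rcases abs_cases (s.1.1 - t.1.1) with ⟨h1, h1'⟩ | ⟨h1, h1'⟩ <;>
      rcases abs_cases (s.1.2 - t.1.2) with ⟨h2, h2'⟩ | ⟨h2, h2'⟩ <;> omega
    · exact exists_ends_of_odd h hs
  · rintro ⟨⟨⟨i, j⟩, a, b⟩, rfl⟩
    rw [ends, SimpleGraph.mem_edgeSet]
    change |_ - _| + |_ - _| = (1 : ℤ)
    simp only [vCell, hCell]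
    cases a <;> cases b <;> simp

theorem coversCells_iff {n : ℕ} (x : EdgeIndex n → Bool) :
    (∀ c, ∃! e, x e = true ∧ c ∈ ends e) ↔
      (∀ j, Covers fun i a b => x ((i, j), (a, b))) ∧
      (∀ i, Covers fun j b a => x ((i, j), (a, b))) := by
  constructor
  · intro h
    refine ⟨fun j k hk => ?_, fun i k hk => ?_⟩
    · have hj := j.2
      let c : Cell n := ⟨((k : ℤ) - j - 1, (k : ℤ) + j - n), by
        rw [inDiamond_iff_linear]; omega⟩
      have hc : ∀ e : EdgeIndex n, c ∈ ends e ↔ e.1.2 = j ∧ e.1.1.val + e.2.1.toNat = k := by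
        intro e
        rw [ends, Sym2.mem_iff, vCell_eq_iff, hCell_eq_iff, Fin.ext_iff]
        simp only [c]
        omega
      obtain ⟨⟨⟨i, j'⟩, a, b⟩, ⟨h1, h2⟩, h3⟩ := h c
      obtain ⟨rfl, h4⟩ := (hc _).1 h2
      refine ⟨(i, a, b), ⟨h1, h4⟩, ?_⟩
      rintro ⟨i', a', b'⟩ ⟨h1', h2'⟩
      have := h3 ((i', j'), (a', b')) ⟨h1', (hc _).2 ⟨rfl, h2'⟩⟩
      simp_all
    · have hi := i.2
      let c : Cell n := ⟨((i : ℤ) - k, (i : ℤ) + k - n), by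
        rw [inDiamond_iff_linear]; omega⟩
      have hc : ∀ e : EdgeIndex n, c ∈ ends e ↔ e.1.1 = i ∧ e.1.2.val + e.2.2.toNat = k := by
        intro e
        rw [ends, Sym2.mem_iff, vCell_eq_iff, hCell_eq_iff, Fin.ext_iff]
        simp only [c]
        omega
      obtain ⟨⟨⟨i', j⟩, a, b⟩, ⟨h1, h2⟩, h3⟩ := h c
      obtain ⟨rfl, h4⟩ := (hc _).1 h2
      refine ⟨(j, b, a), ⟨h1, h4⟩, ?_⟩
      rintro ⟨j', b', a'⟩ ⟨h1', h2'⟩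
      have := h3 ((i', j'), (a', b')) ⟨h1', (hc _).2 ⟨rfl, h2'⟩⟩
      simp_all
  · rintro ⟨hv, hh⟩ ⟨⟨α, β⟩, hc⟩
    rw [inDiamond_iff_linear] at hc
    -- Parity decides whether the square lies on a row chain or a column chain; `k` is its position
    -- there.
    rcases Int.emod_two_eq_zero_or_one (α + β + n) with hs | hs
    · obtain ⟨i, hi⟩ : ∃ i : Fin n, 2 * (i : ℤ) = α + β + n :=
        ⟨⟨((α + β + n) / 2).toNat, by omega⟩, by simp only; omega⟩
      obtain ⟨k, hk⟩ : ∃ k : ℕ, 2 * (k : ℤ) = β - α + n :=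
        ⟨((β - α + n) / 2).toNat, by omega⟩
      have hc : ∀ e : EdgeIndex n, (⟨(α, β), inDiamond_iff_linear.2 hc⟩ : Cell n) ∈ ends e ↔
          e.1.1 = i ∧ e.1.2.val + e.2.2.toNat = k := by
        intro e
        rw [ends, Sym2.mem_iff, vCell_eq_iff, hCell_eq_iff, Fin.ext_iff]
        simp only
        omega
      obtain ⟨⟨j, b, a⟩, ⟨h1, h2⟩, h3⟩ := hh i k (by omega)
      refine ⟨((i, j), (a, b)), ⟨h1, (hc _).2 ⟨rfl, h2⟩⟩, ?_⟩
      rintro ⟨⟨i', j'⟩, a', b'⟩ ⟨h1', h2'⟩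
      obtain ⟨rfl, h2'⟩ := (hc _).1 h2'
      have := h3 (j', b', a') ⟨h1', h2'⟩
      simp_all
    · obtain ⟨j, hj⟩ : ∃ j : Fin n, 2 * (j : ℤ) = β - α + n - 1 :=
        ⟨⟨((β - α + n - 1) / 2).toNat, by omega⟩, by simp only; omega⟩
      obtain ⟨k, hk⟩ : ∃ k : ℕ, 2 * (k : ℤ) = α + β + n + 1 :=
        ⟨((α + β + n + 1) / 2).toNat, by omega⟩
      have hc : ∀ e : EdgeIndex n, (⟨(α, β), inDiamond_iff_linear.2 hc⟩ : Cell n) ∈ ends e ↔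
          e.1.2 = j ∧ e.1.1.val + e.2.1.toNat = k := by
        intro e
        rw [ends, Sym2.mem_iff, vCell_eq_iff, hCell_eq_iff, Fin.ext_iff]
        simp only
        omega
      obtain ⟨⟨i, a, b⟩, ⟨h1, h2⟩, h3⟩ := hv j k (by omega)
      refine ⟨((i, j), (a, b)), ⟨h1, (hc _).2 ⟨rfl, h2⟩⟩, ?_⟩
      rintro ⟨⟨i', j'⟩, a', b'⟩ ⟨h1', h2'⟩
      obtain ⟨rfl, h2'⟩ := (hc _).1 h2'
      have := h3 (i', a', b') ⟨h1', h2'⟩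
      simp_all

/-! ### The alternating sign matrix of a matching -/

/-- The number of selected edges at each site, minus one. -/
def excess {n : ℕ} (x : Fin n → Fin n → Bool → Bool → Bool) : Matrix (Fin n) (Fin n) ℤ :=
  fun i j => degree (x i j) false + degree (x i j) true - 1

theorem degree_flip (z : Bool → Bool → Bool) :
    degree (flip z) false + degree (flip z) true = degree z false + degree z true := by
  simp only [degree, flip]
  ring

/-- The selection `x` covers each unit square exactly once. -/
def IsMatching {n : ℕ} (x : Fin n → Fin n → Bool → Bool → Bool) : Prop :=
  (∀ j, Covers fun i => x i j) ∧ ∀ i, Covers fun j => flip (x i j)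

theorem IsMatching.isASM_excess {n : ℕ} {x : Fin n → Fin n → Bool → Bool → Bool}
    (hx : IsMatching x) : IsASM (excess x) :=
  isASM_iff_partialSum.2
    ⟨fun i => (hx.2 i).partialSum_mem fun j => by rw [degree_flip]; rfl,
      fun j => (hx.1 j).partialSum_mem fun _ => rfl⟩

theorem isMatching_and_excess_eq_iff {n : ℕ} {A : Matrix (Fin n) (Fin n) ℤ} (hA : IsASM A)
    (x : Fin n → Fin n → Bool → Bool → Bool) :
    (IsMatching x ∧ excess x = A) ↔
      ∀ i j, (degree (x i j) false = 1 - partialSum (fun i => A i j) i ∧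
          degree (x i j) true = partialSum (fun i => A i j) (i + 1)) ∧
        (degree (flip (x i j)) false = 1 - partialSum (fun j => A i j) j ∧
          degree (flip (x i j)) true = partialSum (fun j => A i j) (j + 1)) := by
  rw [isASM_iff_partialSum] at hA
  have hcol j := covers_iff_partialSum (y := fun i => x i j) (hA.2 j).1
  have hrow i := covers_iff_partialSum (y := fun j => flip (x i j)) (hA.1 i).1
  constructor
  · rintro ⟨hx, rfl⟩ i j
    exact ⟨(hcol j).1 ⟨hx.1 j, fun _ => rfl⟩ i,
      (hrow i).1 ⟨hx.2 i, fun j => by rw [degree_flip]; rfl⟩ j⟩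
  · intro h
    have h1 j := (hcol j).2 fun i => (h i j).1
    have h2 i := (hrow i).2 fun j => (h i j).2
    refine ⟨⟨fun j => (h1 j).1, fun i => (h2 i).1⟩, ?_⟩
    ext i j
    exact ((h1 j).2 i).symm

/-- View `z` as a 2 × 2 matrix of zeros and ones with prescribed row and column sums. A total of 0
or 1 determines it; a total of 2 leaves the two permutation matrices. -/
theorem card_local {α β γ δ : ℤ} (hα : α = 0 ∨ α = 1) (hβ : β = 0 ∨ β = 1) (hγ : γ = 0 ∨ γ = 1)
    (hδ : δ = 0 ∨ δ = 1) (h : α + β = γ + δ) :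
    #{z : Bool → Bool → Bool | (degree z false = α ∧ degree z true = β) ∧
      (degree (flip z) false = γ ∧ degree (flip z) true = δ)} = if α + β = 2 then 2 else 1 := by
  rcases hα with rfl | rfl <;> rcases hβ with rfl | rfl <;> rcases hγ with rfl | rfl <;>
    rcases hδ with rfl | rfl <;> first | (exfalso; omega) | decide

open Classical in
theorem card_fibre {n : ℕ} {A : Matrix (Fin n) (Fin n) ℤ} (hA : IsASM A) :
    #{x : Fin n → Fin n → Bool → Bool → Bool | IsMatching x ∧ excess x = A} = 2 ^ numOnes A := by
  have hpi : ({x : Fin n → Fin n → Bool → Bool → Bool | IsMatching x ∧ excess x = A} : Finset _) =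
      Fintype.piFinset fun i : Fin n => Fintype.piFinset fun j : Fin n =>
        ({z : Bool → Bool → Bool | (degree z false = 1 - partialSum (fun i => A i j) i ∧
          degree z true = partialSum (fun i => A i j) (i + 1)) ∧
        (degree (flip z) false = 1 - partialSum (fun j => A i j) j ∧
          degree (flip z) true = partialSum (fun j => A i j) (j + 1))} : Finset _) := by
    ext x
    simp only [mem_filter_univ, isMatching_and_excess_eq_iff hA, Fintype.mem_piFinset]
  rw [hpi, Fintype.card_piFinset]
  have hloc : ∀ i j : Fin n, #({z : Bool → Bool → Bool |
        (degree z false = 1 - partialSum (fun i => A i j) i ∧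
          degree z true = partialSum (fun i => A i j) (i + 1)) ∧
        (degree (flip z) false = 1 - partialSum (fun j => A i j) j ∧
          degree (flip z) true = partialSum (fun j => A i j) (j + 1))} : Finset _) =
      if A i j = 1 then 2 else 1 := by
    intro i j
    have hA' := isASM_iff_partialSum.1 hA
    have h1 := (hA'.2 j).2 i i.2.le
    have h2 := (hA'.2 j).2 (i + 1) i.2
    have h3 := (hA'.1 i).2 j j.2.le
    have h4 := (hA'.1 i).2 (j + 1) j.2
    have h5 := partialSum_succ (fun i => A i j) i
    have h6 := partialSum_succ (fun j => A i j) j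
    -- The site carries `1 + A i j` edges, so the two-choice case is exactly an entry 1.
    have h7 : 1 - partialSum (fun i => A i j) i + partialSum (fun i => A i j) (i + 1) = 2 ↔
        A i j = 1 := by
      rw [h5]
      constructor <;> intro h <;> linarith
    simp only [← h7]
    exact card_local (α := 1 - partialSum (fun i => A i j) i)
      (γ := 1 - partialSum (fun j => A i j) j) (by omega) h2 (by omega) h4 (by linarith)
  simp only [Fintype.card_piFinset, hloc]
  rw [numOnes, ← prod_const, prod_filter, Fintype.prod_prod_type]

/-- Selections of edges, indexed by coordinates. -/
def curryEdges (n : ℕ) : (EdgeIndex n → Bool) ≃ (Fin n → Fin n → Bool → Bool → Bool) where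
  toFun x i j a b := x ((i, j), (a, b))
  invFun x e := x e.1.1 e.1.2 e.2.1 e.2.2
  left_inv _ := rfl
  right_inv _ := rfl

open Classical in
theorem numPerfectMatchings_eq (n : ℕ) :
    numPerfectMatchings (graph n) =
      #{x : Fin n → Fin n → Bool → Bool → Bool | IsMatching x} := by
  rw [numPerfectMatchings, card_perfectMatching_eq (graph n) ends (ends_injective n)
    mem_edgeSet_iff, ← Fintype.card_subtype, ← Nat.card_eq_fintype_card]
  exact Nat.card_congr ((curryEdges n).subtypeEquiv fun x => coversCells_iff x)

end Aztec

theorem mainTheorem3 (n : ℕ) :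
    Aztec.numPerfectMatchings (Aztec.graph n) = ∑ A ∈ Aztec.ASM n, 2 ^ Aztec.numOnes A := by
  classical
  rw [Aztec.numPerfectMatchings_eq, Finset.card_eq_sum_card_fiberwise (f := Aztec.excess)
    (t := Aztec.ASM n) fun x hx => Aztec.mem_ASM.2 (Finset.mem_filter_univ x |>.1 hx).isASM_excess]
  refine Finset.sum_congr rfl fun A hA => ?_
  rw [Finset.filter_filter, ← Aztec.card_fibre (Aztec.mem_ASM.1 hA)]
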